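/- Let $A$ be an integral domain with field of fractions $K$ and Krull dimension $\dim A \ge 2$ (possibly infinite). Recall that $A$ is a \emph{Krull ring} if there is a family $(v_i)_{i\in I}$ of discrete valuations on $K$ (i.e. with value group isomorphic to $\mathbb{Z}$) such that $A$ is the intersection of the valuation rings of the $v_i$ and, for every nonzero $x\in K$, $v_i(x)\neq 0$ for only finitely many $i\in I$. A ring $A$ is a \emph{Poonen ring} if for every nonempty open subscheme $U\subset \operatorname{Spec}(A)$ and every dominant morphism of schemes $f: X\to U$ of finite presentation, there is a point $x\in X$ whose residue field $\kappa(x)$ is a purely inseparable extension of $\kappa(f(x))$ (the trivial extension being allowed). (1) If $A$ is a Krull ring, then $A$ is a Poonen ring. (2) In particular, if $A$ is factorial (a unique factorization domain), then $A$ is a Poonen ring. -/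

import Mathlib

open AlgebraicGeometry
open scoped WithZero

universe u

/-- A domain `A` with field of fractions `K` is a Krull ring if there is a family of discrete
valuations on `K`, normalized here to have value group exactly `ℤ` (written multiplicatively, with
a zero adjoined), such that `A` is the intersection of their valuation rings and every nonzero
element of `K` has a nontrivial value at only finitely many of them. The family may be empty, so
that fields are Krull rings. -/
def IsKrullRing (A : Type u) [CommRing A] [IsDomain A] : Prop :=
  ∃ 𝒱 : Set (Valuation (FractionRing A) ℤᵐ⁰),
    (∀ v ∈ 𝒱, Function.Surjective v) ∧
    (∀ x : FractionRing A,
      x ∈ (algebraMap A (FractionRing A)).range ↔ ∀ v ∈ 𝒱, v x ≤ 1) ∧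
    (∀ x : FractionRing A, x ≠ 0 → {v | v ∈ 𝒱 ∧ v x ≠ 1}.Finite)

/-- The residue field of `x` is a purely inseparable extension of the residue field
of `f x`, where the extension is the one induced by `f`. -/
def IsPurelyInseparableAt {X S : Scheme.{u}} (f : X ⟶ S) (x : X) : Prop :=
  letI : Algebra (S.residueField (f x)) (X.residueField x) := (f.residueFieldMap x).hom.toAlgebra
  IsPurelyInseparable (S.residueField (f x)) (X.residueField x)

/-- The set of points of the target of `f` that can be quasi-lifted along `f`. -/
def QRel {X S : Scheme.{u}} (f : X ⟶ S) : Set S :=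
  f '' {x | IsPurelyInseparableAt f x}

/-- Poonen schemes: every dominant morphism of finite presentation (that is, locally of finite
presentation, quasi-compact and quasi-separated) to a nonempty open subscheme has a point whose
residue field is purely inseparable over that of its image. -/
def IsPoonenScheme (S : Scheme.{u}) : Prop :=
  ∀ U : S.Opens, (U : Set S).Nonempty →
    ∀ (X : Scheme.{u}) (f : X ⟶ U.toScheme),
      LocallyOfFinitePresentation f → QuasiCompact f → QuasiSeparated f → IsDominant f →
        (QRel f).Nonempty

/-- A ring is a Poonen ring if its spectrum is a Poonen scheme. -/
def IsPoonenRing (A : Type u) [CommRing A] : Prop :=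
  IsPoonenScheme (Spec (CommRingCat.of A))

/-! Both cases reduce to the condition `HasSparsePrimes`, where dimension at least 2 supplies the
ideal m lying in no prime of P. For a Krull ring, P consists of the centers of the valuations left
after discarding those whose center strictly contains a nonzero prime; for a factorial ring, P
consists of the principal primes generated by prime elements.

The core is `Polynomial.Monic.exists_mem_prime_eval_scaleRoots`: a monic f over A with nonzero
constant term acquires a root c/x in the fraction field of A/p for some p in P avoiding a prescribed
g. One makes the homogenized value x^d f(c/x) equal to f(0) times a nonzero nonunit of m, and takes
p to be a prime of P containing that nonunit.

Dominance gives an affine open of X whose ring B contains A, and B maps to a finite extension L of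
K. Let α be integral over A and generate the separable closure of K in L. A root of its minimal
polynomial in κ(p) gives A[α] → κ(p), which extends to a place of L. A power of the exponential
characteristic brings each generator of B into A[α], up to a denominator outside p. So B lands in
the valuation ring, with residues purely inseparable over those of A. -/

/-! ### Centers of valuations and Krull families -/

/-- The elements of `A` with value less than one, for a valuation whose ring contains `A`. -/
def Valuation.centerIdeal {A K Γ : Type*} [CommRing A] [Field K] [Algebra A K]
    [LinearOrderedCommGroupWithZero Γ] (v : Valuation K Γ)
    (hv : ∀ a : A, v (algebraMap A K a) ≤ 1) : Ideal A where
  carrier := {a | v (algebraMap A K a) < 1}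
  zero_mem' := by simp
  add_mem' {a b} ha hb := by
    simp only [Set.mem_ofPred_eq, map_add] at *
    exact (v.map_add _ _).trans_lt (max_lt ha hb)
  smul_mem' a b hb := by
    simp only [Set.mem_ofPred_eq, smul_eq_mul, map_mul] at *
    exact (mul_le_of_le_one_left' (hv a)).trans_lt hb

theorem Valuation.mem_centerIdeal {A K Γ : Type*} [CommRing A] [Field K] [Algebra A K]
    [LinearOrderedCommGroupWithZero Γ] {v : Valuation K Γ}
    {hv : ∀ a : A, v (algebraMap A K a) ≤ 1} {a : A} :
    a ∈ v.centerIdeal hv ↔ v (algebraMap A K a) < 1 := Iff.rfl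

theorem Valuation.centerIdeal_isPrime {A K Γ : Type*} [CommRing A] [Field K] [Algebra A K]
    [LinearOrderedCommGroupWithZero Γ] (v : Valuation K Γ)
    (hv : ∀ a : A, v (algebraMap A K a) ≤ 1) : (v.centerIdeal hv).IsPrime := by
  refine ⟨(Ideal.ne_top_iff_one _).2 (by simp [mem_centerIdeal]), fun {a b} h => ?_⟩
  rw [mem_centerIdeal, map_mul, map_mul] at h
  by_contra! hcon
  simp only [mem_centerIdeal, not_lt] at hcon
  rw [le_antisymm (hv a) hcon.1, le_antisymm (hv b) hcon.2, one_mul] at h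
  exact lt_irrefl _ h

/-- A family of valuations with integer values whose rings intersect in `A`, and which is
locally finite. -/
structure IsKrullFamily (A : Type*) {K : Type*} [CommRing A] [Field K] [Algebra A K]
    (V : Set (Valuation K ℤᵐ⁰)) : Prop where
  mem_range_iff : ∀ x : K, x ∈ (algebraMap A K).range ↔ ∀ v ∈ V, v x ≤ 1
  finite : ∀ x : K, x ≠ 0 → {v | v ∈ V ∧ v x ≠ 1}.Finite

/-- Take n = log s and e = -log t. That n does not depend on t lets `diff_singleton` treat two
elements with the same n. -/
theorem WithZero.exists_pow_mul_pow_eq_one {s : ℤᵐ⁰} (hs : 1 < s) :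
    ∃ n : ℕ, n ≠ 0 ∧ ∀ t : ℤᵐ⁰, t ≠ 0 → t < 1 → ∃ e : ℕ, e ≠ 0 ∧ s ^ e * t ^ n = 1 := by
  have hs0 : s ≠ 0 := (zero_lt_one.trans hs).ne'
  have hls : 0 < WithZero.log s := by
    have := (WithZero.log_lt_log one_ne_zero hs0).2 hs
    simpa using this
  refine ⟨(WithZero.log s).toNat, by omega, fun t ht0 ht => ?_⟩
  have hlt : WithZero.log t < 0 := by
    have := (WithZero.log_lt_log ht0 one_ne_zero).2 ht
    simpa using this
  refine ⟨(-WithZero.log t).toNat, by omega, ?_⟩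
  rw [← WithZero.exp_log (mul_ne_zero (pow_ne_zero _ hs0) (pow_ne_zero _ ht0)),
    WithZero.log_mul (pow_ne_zero _ hs0) (pow_ne_zero _ ht0), WithZero.log_pow, WithZero.log_pow,
    ← WithZero.exp_zero]
  congr 1
  rw [nsmul_eq_mul, nsmul_eq_mul, Int.toNat_of_nonneg (by omega), Int.toNat_of_nonneg (by omega)]
  ring

namespace IsKrullFamily

variable {A K : Type*} [CommRing A] [Field K] [Algebra A K]
  {V : Set (Valuation K ℤᵐ⁰)}

theorem le_one (h : IsKrullFamily A V) {v : Valuation K ℤᵐ⁰} (hv : v ∈ V) (a : A) :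
    v (algebraMap A K a) ≤ 1 :=
  (h.mem_range_iff _).1 ⟨a, rfl⟩ v hv

theorem isIntegrallyClosed [IsDomain A] [IsFractionRing A K] (h : IsKrullFamily A V) :
    IsIntegrallyClosed A := by
  rw [isIntegrallyClosed_iff K]
  intro x hx
  have : x ∈ (algebraMap A K).range := by
    rw [h.mem_range_iff]
    intro v hv
    refine Valuation.Integers.mem_of_integral (Valuation.integer.integers v)
      (hx.map_of_comp_eq ((algebraMap A K).codRestrict v.integer (h.le_one hv))
        (RingHom.id K) ?_)
    rfl
  exact this

/-- A valuation whose center contains a smaller nonzero prime is superfluous. -/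
theorem diff_singleton [IsDomain A] [IsFractionRing A K] (h : IsKrullFamily A V)
    {v : Valuation K ℤᵐ⁰} (hv : v ∈ V) {q : Ideal A} (hq : q.IsPrime) (hq0 : q ≠ ⊥)
    (hlt : q < v.centerIdeal (h.le_one hv)) : IsKrullFamily A (V \ {v}) := by
  refine ⟨fun x => ⟨fun hx w hw => (h.mem_range_iff x).1 hx w hw.1, fun hx => ?_⟩,
    fun x hx => (h.finite x hx).subset fun w hw => ⟨hw.1.1, hw.2⟩⟩
  rw [h.mem_range_iff]
  by_contra! hcon
  obtain ⟨w, hw, hwx⟩ := hcon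
  obtain rfl : w = v := by
    by_contra hne
    exact hwx.not_ge (hx w ⟨hw, hne⟩)
  obtain ⟨n, hn, hpow⟩ := WithZero.exists_pow_mul_pow_eq_one hwx
  -- Only w obstructs x from lying in A, so balancing x against a to get value 1 at w gives an
  -- element of A outside the center.
  have key : ∀ a : A, a ≠ 0 → a ∈ w.centerIdeal (h.le_one hv) → ∃ e : ℕ, e ≠ 0 ∧
      ∃ z : A, algebraMap A K z = x ^ e * algebraMap A K a ^ n ∧
        z ∉ w.centerIdeal (h.le_one hv) := by
    intro a ha0 ha
    have hne : algebraMap A K a ≠ 0 := by simpa using ha0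
    obtain ⟨e, he, hea⟩ := hpow _ ((map_ne_zero w).2 hne) ha
    have hz : w (x ^ e * algebraMap A K a ^ n) = 1 := by simpa using hea
    have : x ^ e * algebraMap A K a ^ n ∈ (algebraMap A K).range := by
      rw [h.mem_range_iff]
      intro u hu
      by_cases huw : u = w
      · exact huw ▸ hz.le
      · rw [map_mul, map_pow, map_pow]
        exact mul_le_one' (pow_le_one' (hx u ⟨hu, huw⟩) _) (pow_le_one' (h.le_one hu a) _)
    obtain ⟨z, hz'⟩ := this
    refine ⟨e, he, z, hz', ?_⟩
    rw [Valuation.mem_centerIdeal, hz', hz]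
    exact lt_irrefl _
  obtain ⟨a, haq, ha0⟩ := Submodule.exists_mem_ne_zero_of_ne_bot hq0
  obtain ⟨b, hbp, hbq⟩ := SetLike.exists_of_lt hlt
  have hb0 : b ≠ 0 := fun h => hbq (h ▸ q.zero_mem)
  obtain ⟨e, he, y, hy, hyp⟩ := key a ha0 (hlt.le haq)
  obtain ⟨f, hf, z, hz, hzp⟩ := key b hb0 hbp
  -- Both sides are x^(ef) a^(nf) b^(ne). The right side lies in q, while neither y nor b does.
  have heq : y ^ f * b ^ (n * e) = z ^ e * a ^ (n * f) := by
    apply IsFractionRing.injective A K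
    simp only [map_mul, map_pow, hy, hz]
    ring
  have hmem : y ^ f * b ^ (n * e) ∈ q :=
    heq ▸ q.mul_mem_left _ (q.pow_mem_of_mem haq _ (Nat.pos_of_ne_zero (mul_ne_zero hn hf)))
  rcases hq.mem_or_mem hmem with h' | h'
  · exact hyp (hlt.le (hq.mem_of_pow_mem _ h'))
  · exact hbq (hq.mem_of_pow_mem _ h')

theorem diff_finite [IsDomain A] [IsFractionRing A K] (h : IsKrullFamily A V)
    {W : Set (Valuation K ℤᵐ⁰)} (hW : W.Finite)
    (hWV : ∀ v ∈ W, ∃ hv : v ∈ V, ∃ q : Ideal A, q.IsPrime ∧ q ≠ ⊥ ∧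
      q < v.centerIdeal (h.le_one hv)) : IsKrullFamily A (V \ W) := by
  induction W, hW using Set.Finite.induction_on with
  | empty => simpa using h
  | @insert v W hvW _ ih =>
    have h' := ih fun w hw => hWV w (Set.mem_insert_of_mem _ hw)
    obtain ⟨hv, q, hq, hq0, hlt⟩ := hWV v (Set.mem_insert _ _)
    have := h'.diff_singleton (v := v) ⟨hv, hvW⟩ hq hq0 hlt
    rwa [Set.sdiff_sdiff, Set.union_singleton] at this

/-- The members of a Krull family whose center has height at most one still form a Krull family. -/
theorem of_center_height_le_one [IsDomain A] [IsFractionRing A K] (h : IsKrullFamily A V) :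
    IsKrullFamily A {v | ∃ hv : v ∈ V, ∀ q : Ideal A, q.IsPrime → q ≠ ⊥ →
      ¬ q < v.centerIdeal (h.le_one hv)} := by
  refine ⟨fun x => ⟨fun hx v hv => (h.mem_range_iff x).1 hx v hv.1, fun hx => ?_⟩,
    fun x hx => (h.finite x hx).subset fun v hv => ⟨hv.1.1, hv.2⟩⟩
  by_cases hx0 : x = 0
  · exact hx0 ▸ zero_mem _
  -- For a fixed x, only the finitely many valuations with a pole at x need to be removed, so
  -- `diff_finite` suffices.
  have hW : {v | v ∈ V ∧ 1 < v x}.Finite :=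
    (h.finite x hx0).subset fun v hv => ⟨hv.1, hv.2.ne'⟩
  refine ((h.diff_finite hW ?_).mem_range_iff x).2 fun v hv => ?_
  · rintro v ⟨hv, hvx⟩
    by_contra! hcon
    exact hvx.not_ge (hx v ⟨hv, hcon hv⟩)
  · by_contra! hcon
    exact hv.2 ⟨hv.1, hcon⟩

end IsKrullFamily

/-! ### Sparse primes in Krull and factorial rings -/

/-- A domain has sparse primes if there is a set of primes covering the nonzero nonunits, such that
every nonzero element lies in finitely many of them, and some proper nonzero ideal in none. -/
def HasSparsePrimes (A : Type*) [CommRing A] : Prop :=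
  ∃ P : Set (Ideal A), (∀ p ∈ P, p.IsPrime) ∧
    (∀ y : A, y ≠ 0 → ¬ IsUnit y → ∃ p ∈ P, y ∈ p) ∧
    (∀ y : A, y ≠ 0 → {p | p ∈ P ∧ y ∈ p}.Finite) ∧
    ∃ m : Ideal A, m ≠ ⊥ ∧ m ≠ ⊤ ∧ ∀ p ∈ P, ¬ m ≤ p

theorem exists_lt_isPrime_of_two_le_ringKrullDim {A : Type*} [CommRing A] [IsDomain A]
    (hdim : 2 ≤ ringKrullDim A) :
    ∃ p m : Ideal A, p.IsPrime ∧ m.IsPrime ∧ p ≠ ⊥ ∧ p < m := by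
  obtain ⟨s, hs⟩ := Order.le_krullDim_iff.1 (show ((2 : ℕ) : WithBot ℕ∞) ≤ _ from hdim)
  have h01 : s ⟨0, by omega⟩ < s ⟨1, by omega⟩ := s.strictMono (by simp [Fin.lt_def])
  have h12 : s ⟨1, by omega⟩ < s ⟨2, by omega⟩ := s.strictMono (by simp [Fin.lt_def])
  exact ⟨_, _, (s ⟨1, by omega⟩).2, (s ⟨2, by omega⟩).2,
    (bot_le.trans_lt (show (s ⟨0, by omega⟩).asIdeal < _ from h01)).ne', h12⟩

theorem IsKrullFamily.hasSparsePrimes {A K : Type*} [CommRing A] [IsDomain A] [Field K]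
    [Algebra A K] [IsFractionRing A K] {V : Set (Valuation K ℤᵐ⁰)} (h : IsKrullFamily A V)
    (hdim : 2 ≤ ringKrullDim A) : HasSparsePrimes A := by
  obtain ⟨p, m, hp, hm, hp0, hpm⟩ := exists_lt_isPrime_of_two_le_ringKrullDim hdim
  have h' := h.of_center_height_le_one
  set W := {v | ∃ hv : v ∈ V, ∀ q : Ideal A, q.IsPrime → q ≠ ⊥ →
      ¬ q < v.centerIdeal (h.le_one hv)}
  refine ⟨{q | ∃ v, ∃ hv : v ∈ W, q = v.centerIdeal (h'.le_one hv)}, ?_, ?_, ?_,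
    m, (bot_le.trans_lt hpm).ne', hm.ne_top, ?_⟩
  · rintro _ ⟨v, hv, rfl⟩
    exact v.centerIdeal_isPrime _
  · intro y hy0 hyu
    by_contra! hcon
    apply hyu
    have hy : algebraMap A K y ≠ 0 := by simpa using hy0
    have : (algebraMap A K y)⁻¹ ∈ (algebraMap A K).range := by
      rw [h'.mem_range_iff]
      intro v hv
      have := hcon _ ⟨v, hv, rfl⟩
      rw [Valuation.mem_centerIdeal, not_lt] at this
      rw [map_inv₀]
      exact inv_le_one_of_one_le₀ this
    obtain ⟨z, hz⟩ := this
    refine IsUnit.of_mul_eq_one z (IsFractionRing.injective A K ?_)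
    rw [map_mul, hz, map_one, mul_inv_cancel₀ hy]
  · intro y hy
    have hy : algebraMap A K y ≠ 0 := by simpa using hy
    classical
    refine ((h'.finite _ hy).image fun v => if hv : v ∈ W then v.centerIdeal (h'.le_one hv)
      else ⊥).subset ?_
    rintro _ ⟨⟨v, hv, rfl⟩, hyv⟩
    exact ⟨v, ⟨hv, (Valuation.mem_centerIdeal.1 hyv).ne⟩, dif_pos hv⟩
  · rintro _ ⟨v, hv, rfl⟩ hle
    exact hv.2 p hp hp0 (hpm.trans_le hle)

theorem UniqueFactorizationMonoid.hasSparsePrimes {A : Type*} [CommRing A] [IsDomain A]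
    [UniqueFactorizationMonoid A] (hdim : 2 ≤ ringKrullDim A) : HasSparsePrimes A := by
  obtain ⟨p, m, hp, hm, hp0, hpm⟩ := exists_lt_isPrime_of_two_le_ringKrullDim hdim
  refine ⟨{q | ∃ π, Prime π ∧ q = Ideal.span {π}}, ?_, ?_, ?_,
    m, (bot_le.trans_lt hpm).ne', hm.ne_top, ?_⟩
  · rintro _ ⟨π, hπ, rfl⟩
    exact (Ideal.span_singleton_prime hπ.ne_zero).2 hπ
  · intro y hy0 hyu
    obtain ⟨π, hπ, hd⟩ := WfDvdMonoid.exists_irreducible_factor hyu hy0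
    exact ⟨_, ⟨π, UniqueFactorizationMonoid.irreducible_iff_prime.1 hπ, rfl⟩,
      Ideal.mem_span_singleton.2 hd⟩
  · intro y hy
    refine ((UniqueFactorizationMonoid.factors y).finite_toSet.image
      fun π => Ideal.span {π}).subset ?_
    rintro _ ⟨⟨π, hπ, rfl⟩, hyπ⟩
    obtain ⟨ρ, hρ, hass⟩ := UniqueFactorizationMonoid.exists_mem_factors_of_dvd hy hπ.irreducible
      (Ideal.mem_span_singleton.1 hyπ)
    exact ⟨ρ, hρ, Ideal.span_singleton_eq_span_singleton.2 hass.symm⟩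
  · rintro _ ⟨π, hπ, rfl⟩ hle
    -- A principal prime containing m contains ρ, so is generated by ρ and lies in p, which is
    -- strictly inside m.
    obtain ⟨ρ, hρp, hρ⟩ := hp.exists_mem_prime_of_ne_bot hp0
    have hdvd : π ∣ ρ := Ideal.mem_span_singleton.1 (hle (hpm.le hρp))
    have hass := hπ.associated_of_dvd hρ hdvd
    apply (hpm.trans_le hle).not_ge
    rw [Ideal.span_singleton_eq_span_singleton.2 hass]
    exact (Ideal.span_singleton_le_iff_mem _).2 hρp

/-! ### Roots of polynomials modulo a sparse prime -/

open Polynomial in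
theorem Polynomial.Monic.exists_mem_prime_eval_scaleRoots {A : Type*} [CommRing A] [IsDomain A]
    {P : Set (Ideal A)} (hprime : ∀ p ∈ P, p.IsPrime)
    (hcover : ∀ y : A, y ≠ 0 → ¬ IsUnit y → ∃ p ∈ P, y ∈ p)
    (hfin : ∀ y : A, y ≠ 0 → {p | p ∈ P ∧ y ∈ p}.Finite)
    {m : Ideal A} (hm0 : m ≠ ⊥) (hm1 : m ≠ ⊤) (hm : ∀ p ∈ P, ¬ m ≤ p)
    {f : A[X]} (hf : f.Monic) (hdeg : f.natDegree ≠ 0) (hf0 : f.coeff 0 ≠ 0)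
    {g : A} (hg : g ≠ 0) :
    ∃ p ∈ P, ∃ x c : A, x ∉ p ∧ g ∉ p ∧ (f.scaleRoots x).eval c ∈ p := by
  have hunit : ∀ y ∈ m, ¬ IsUnit y := fun y hy hu => hm1 (m.eq_top_of_isUnit_mem hy hu)
  -- Prime avoidance: m lies in none of the finitely many primes of P containing y.
  have avoid : ∀ y : A, y ≠ 0 → ∃ z ∈ m, ∀ p ∈ P, y ∈ p → z ∉ p := by
    intro y hy
    by_contra! hcon
    have hsub : (m : Set A) ⊆ ⋃ i ∈ (↑(hfin y hy).toFinset : Set (Ideal A)), (i : Set A) := by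
      intro z hz
      obtain ⟨p, hp, hyp, hzp⟩ := hcon z hz
      simp only [Set.Finite.coe_toFinset, Set.mem_iUnion]
      exact ⟨p, ⟨hp, hyp⟩, hzp⟩
    obtain ⟨p, hp, hle⟩ := (Ideal.subset_union_prime (f := id) ⊥ ⊥
      (fun i hi _ _ => hprime i ((hfin y hy).mem_toFinset.1 hi).1)).1 hsub
    exact hm p ((hfin y hy).mem_toFinset.1 hp).1 hle
  obtain ⟨e, hem, he0⟩ := Submodule.exists_mem_ne_zero_of_ne_bot hm0
  set c₀ := f.coeff 0 with hc₀
  -- The factor e puts g' in m; p will avoid g', hence both g and c₀.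
  set g' := g * c₀ * e with hg'
  have hg'0 : g' ≠ 0 := mul_ne_zero (mul_ne_zero hg hf0) he0
  obtain ⟨p₁, hp₁, hgp₁⟩ := hcover g' hg'0 (hunit _ (m.mul_mem_left _ hem))
  obtain ⟨x, hxm, hx⟩ := avoid g' hg'0
  have hx0 : x ≠ 0 := fun h => hx p₁ hp₁ hgp₁ (h ▸ p₁.zero_mem)
  obtain ⟨a, ham, ha⟩ := avoid x hx0
  set c := c₀ * g' * a with hc
  set w := (f.scaleRoots x).divX.eval c with hw
  set d := f.natDegree with hd
  -- Since c₀ divides c and the constant term c₀ x^d, it factors out.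
  have hval : (f.scaleRoots x).eval c = c₀ * (x ^ d + g' * a * w) := by
    conv_lhs => rw [← divX_mul_X_add (f.scaleRoots x)]
    simp only [eval_add, eval_mul, eval_X, eval_C, coeff_scaleRoots]
    rw [← hw, hc]
    simp only [← hd, ← hc₀, Nat.sub_zero]
    ring
  have hbad : ∀ p ∈ P, g' ∈ p → x ^ d + g' * a * w ∉ p := by
    intro p hp hgp hmem
    have : x ^ d ∈ p := by
      have := p.sub_mem hmem (p.mul_mem_right w (p.mul_mem_right a hgp))
      rwa [add_sub_cancel_right] at this
    exact hx p hp hgp ((hprime p hp).mem_of_pow_mem _ this)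
  have hy0 : x ^ d + g' * a * w ≠ 0 := fun h => hbad p₁ hp₁ hgp₁ (h ▸ p₁.zero_mem)
  have hym : x ^ d + g' * a * w ∈ m :=
    m.add_mem (m.pow_mem_of_mem hxm _ (Nat.pos_of_ne_zero hdeg))
      (m.mul_mem_right _ (m.mul_mem_left _ ham))
  obtain ⟨p, hp, hyp⟩ := hcover _ hy0 (hunit _ hym)
  have hpp := hprime p hp
  have hg'p : g' ∉ p := fun h => hbad p hp h hyp
  have hmem : (f.scaleRoots x).eval c ∈ p := hval ▸ p.mul_mem_left _ hyp
  refine ⟨p, hp, x, c, fun hxp => ?_,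
    fun h => hg'p (p.mul_mem_right _ (p.mul_mem_right _ h)), hmem⟩
  -- Modulo x the homogenized value is c^d, because f is monic.
  have hcp : c ∈ p := by
    rw [← Ideal.Quotient.eq_zero_iff_mem] at hmem hxp ⊢
    rw [← eval_map_apply, map_scaleRoots _ _ _ (by simp [hf.leadingCoeff]), hxp,
      scaleRoots_zero, (hf.map _).leadingCoeff] at hmem
    exact And.left (by simpa [hf.natDegree_map, hdeg] using hmem)
  rcases hpp.mem_or_mem hcp with h | h
  · rcases hpp.mem_or_mem h with h | h
    · exact hg'p (p.mul_mem_right _ (p.mul_mem_left _ h))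
    · exact hg'p h
  · exact ha p hp hxp h

/-! ### From a root to a valuation ring -/

/-- As A is integrally closed, A[α] is A[X] modulo `minpoly A α`, so α may be sent to the root c/x
in κ(p). -/
theorem exists_adjoin_algHom_residueField {A L : Type*} [CommRing A] [IsDomain A]
    [IsIntegrallyClosed A] [Field L] [Algebra A L] [Module.IsTorsionFree A L]
    {α : L} (hα : IsIntegral A α) {p : Ideal A} [p.IsPrime] {x c : A} (hx : x ∉ p)
    (hroot : ((minpoly A α).scaleRoots x).eval c ∈ p) :
    ∃ θ : Algebra.adjoin A {α} →ₐ[A] p.ResidueField,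
      θ (algebraMap A _ x * ⟨α, Algebra.self_mem_adjoin_singleton A α⟩ - algebraMap A _ c) = 0 := by
  have hx' : algebraMap A p.ResidueField x ≠ 0 := by
    rwa [Ne, Ideal.algebraMap_residueField_eq_zero]
  have hev : (minpoly A α).eval₂ (algebraMap A p.ResidueField)
      (algebraMap A p.ResidueField c / algebraMap A p.ResidueField x) = 0 := by
    have h := Polynomial.scaleRoots_eval₂_mul (p := minpoly A α) (algebraMap A p.ResidueField)
      (algebraMap A p.ResidueField c / algebraMap A p.ResidueField x) x
    rw [mul_div_cancel₀ _ hx', Polynomial.eval₂_at_apply,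
      Ideal.algebraMap_residueField_eq_zero.2 hroot] at h
    exact (mul_eq_zero.1 h.symm).resolve_left (pow_ne_zero _ hx')
  let θ₀ := AdjoinRoot.liftAlgHom (minpoly A α) (Algebra.ofId A p.ResidueField) _ hev
  refine ⟨θ₀.comp (minpoly.equivAdjoin hα).symm.toAlgHom, ?_⟩
  have hroot : (minpoly.equivAdjoin hα).symm ⟨α, Algebra.self_mem_adjoin_singleton A α⟩ =
      AdjoinRoot.root _ := by
    rw [AlgEquiv.symm_apply_eq]
    ext
    simp
  have h1 : (θ₀.comp (minpoly.equivAdjoin hα).symm.toAlgHom)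
      ⟨α, Algebra.self_mem_adjoin_singleton A α⟩ =
      algebraMap A p.ResidueField c / algebraMap A p.ResidueField x := by
    change θ₀ ((minpoly.equivAdjoin hα).symm _) = _
    rw [hroot]
    exact AdjoinRoot.liftAlgHom_root _ _ _ _
  rw [map_sub, map_mul, h1, AlgHom.commutes, AlgHom.commutes, mul_div_cancel₀ _ hx', sub_self]

/-- Localize the image of R at the kernel of θ and choose a valuation ring dominating it. -/
theorem exists_valuationSubring_of_ringHom {R L κ : Type*} [CommRing R] [Field L] [Field κ]
    {i : R →+* L} (hi : Function.Injective i) (θ : R →+* κ) :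
    ∃ O : ValuationSubring L, ∃ h : ∀ r, i r ∈ O, ∀ r,
      IsLocalRing.residue O ⟨i r, h r⟩ = 0 ↔ θ r = 0 := by
  let e : R ≃+* i.range := RingEquiv.ofBijective i.rangeRestrict
    ⟨fun a b h => hi congr(($h).1), i.rangeRestrict_surjective⟩
  let θ' : i.range →+* κ := θ.comp e.symm.toRingHom
  have : (RingHom.ker θ').IsPrime := RingHom.ker_isPrime θ'
  obtain ⟨O, hO⟩ := LocalSubring.exists_le_valuationSubring
    (LocalSubring.ofPrime i.range (RingHom.ker θ'))
  have hle := LocalSubring.le_ofPrime i.range (RingHom.ker θ')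
  obtain ⟨hO, hloc⟩ := hO
  have hmem : ∀ r, i r ∈ O := fun r => hO (hle ⟨r, rfl⟩)
  refine ⟨O, hmem, fun r => ?_⟩
  have hθ : θ r = θ' (e r) := by simp [θ']
  have h1 : IsUnit (algebraMap i.range
      (LocalSubring.ofPrime i.range (RingHom.ker θ')).toSubring (e r)) ↔ θ r ≠ 0 := by
    rw [IsLocalization.AtPrime.isUnit_to_map_iff _ (RingHom.ker θ'), hθ]
    rfl
  rw [IsLocalRing.residue_eq_zero_iff, IsLocalRing.mem_maximalIdeal, mem_nonunits_iff,
    not_iff_comm, ← Ne, ← h1]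
  constructor
  · intro h
    exact h.map (Subring.inclusion hO)
  · intro h
    exact hloc.map_nonunit _ h

/-- If q = 1 the power is z itself, whatever the characteristic of F; if q is prime, q = 0 in A and
hence in F. -/
theorem mem_perfectClosure_of_pow_mem {A K Ω : Type*} [CommRing A] [Field K] [Algebra A K]
    [FaithfulSMul A K] [Field Ω] {q : ℕ} [hq : ExpChar K q] (φ : A →+* Ω) (F : Subfield Ω) {z : Ω}
    {n : ℕ} (hz : z ^ q ^ n ∈ F) : z ∈ perfectClosure F Ω := by
  rcases hq with _ | hp
  · rw [one_pow, pow_one] at hz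
    exact (perfectClosure F Ω).algebraMap_mem ⟨z, hz⟩
  · have hA : (q : A) = 0 := by
      apply FaithfulSMul.algebraMap_injective A K
      rw [map_natCast, CharP.cast_eq_zero, map_zero]
    have hΩ : (q : F) = 0 := by
      ext
      simpa using congr(φ $hA)
    have := (CharP.charP_iff_prime_eq_zero hp).2 hΩ
    have : ExpChar F q := ExpChar.prime hp
    exact (mem_perfectClosure_iff_pow_mem q).2 ⟨n, ⟨_, hz⟩, rfl⟩

-- L is purely inseparable over the separable closure of K, which has a primitive element α; g
-- clears finitely many denominators.
open IntermediateField in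
theorem exists_integral_and_pow_mem_adjoin (A K : Type*) {L : Type*} [CommRing A] [IsDomain A]
    [Field K] [Algebra A K] [IsFractionRing A K] [Field L] [Algebra K L] [Algebra A L]
    [IsScalarTower A K L] [FiniteDimensional K L] (s : Finset L) :
    ∃ α : L, α ≠ 0 ∧ IsIntegral A α ∧ ∃ g : A, g ≠ 0 ∧ (∀ z ∈ s, IsIntegral A (g • z)) ∧
      ∀ z ∈ s, ∃ n : ℕ, g • z ^ ringExpChar K ^ n ∈ Algebra.adjoin A {α} := by
  classical
  obtain ⟨α, hα0, hα⟩ : ∃ α : L, α ≠ 0 ∧ K⟮α⟯ = separableClosure K L := by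
    obtain ⟨β, hβ⟩ := Field.exists_primitive_element K (separableClosure K L)
    have hβ' : K⟮(β : L)⟯ = separableClosure K L := by
      have := congr_arg (IntermediateField.map (separableClosure K L).val) hβ
      rwa [IntermediateField.adjoin_map, Set.image_singleton, ← AlgHom.fieldRange_eq_map,
        IntermediateField.fieldRange_val] at this
    -- A zero generator is replaced by 1, so that the minimal polynomial will have nonzero constant
    -- term.
    by_cases h : (β : L) = 0
    · refine ⟨1, one_ne_zero, ?_⟩
      rw [← hβ', h, IntermediateField.adjoin_one, IntermediateField.adjoin_zero]
    · exact ⟨β, h, hβ'⟩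
  obtain ⟨y, hy0, hy⟩ := exists_integral_multiples A K (insert α s)
  have hyK : algebraMap A K y ≠ 0 := by simpa using hy0
  have key : ∀ u ∈ Algebra.adjoin K {α}, ∃ a : A, a ≠ 0 ∧ a • u ∈ Algebra.adjoin A {y • α} := by
    intro u hu
    induction hu using Algebra.adjoin_induction with
    | mem u hu =>
      rw [Set.mem_singleton_iff.1 hu]
      exact ⟨y, hy0, Algebra.self_mem_adjoin_singleton _ _⟩
    | algebraMap r =>
      obtain ⟨a, b, hb, rfl⟩ := IsFractionRing.div_surjective (A := A) r
      refine ⟨b, nonZeroDivisors.ne_zero hb, ?_⟩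
      have hb' : algebraMap A L b ≠ 0 := by
        rw [IsScalarTower.algebraMap_apply A K L]
        simpa using nonZeroDivisors.ne_zero hb
      rw [Algebra.smul_def b, map_div₀, ← IsScalarTower.algebraMap_apply,
        ← IsScalarTower.algebraMap_apply, mul_div_cancel₀ _ hb']
      exact Subalgebra.algebraMap_mem _ _
    | add u v _ _ hu hv =>
      obtain ⟨a, ha0, ha⟩ := hu
      obtain ⟨b, hb0, hb⟩ := hv
      refine ⟨a * b, mul_ne_zero ha0 hb0, ?_⟩
      have : (a * b) • (u + v) = b • a • u + a • b • v := by
        rw [smul_smul, smul_smul, smul_add, mul_comm b a]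
      rw [this]
      exact add_mem (Subalgebra.smul_mem _ ha _) (Subalgebra.smul_mem _ hb _)
    | mul u v _ _ hu hv =>
      obtain ⟨a, ha0, ha⟩ := hu
      obtain ⟨b, hb0, hb⟩ := hv
      refine ⟨a * b, mul_ne_zero ha0 hb0, ?_⟩
      rw [← smul_mul_smul_comm]
      exact mul_mem ha hb
  have hpow : ∀ z : L, ∃ n : ℕ, ∃ a : A, a ≠ 0 ∧
      a • z ^ ringExpChar K ^ n ∈ Algebra.adjoin A {y • α} := by
    intro z
    obtain ⟨n, w, hw⟩ := IsPurelyInseparable.pow_mem (separableClosure K L) (ringExpChar K) z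
    refine ⟨n, key _ ?_⟩
    have hmem : z ^ ringExpChar K ^ n ∈ K⟮α⟯ := by
      rw [hα, ← hw]
      exact w.2
    rwa [← IntermediateField.mem_toSubalgebra,
      IntermediateField.adjoin_simple_toSubalgebra_of_isAlgebraic
        (Algebra.IsAlgebraic.isAlgebraic α)] at hmem
  choose n a ha0 ha using hpow
  refine ⟨y • α, ?_, hy α (Finset.mem_insert_self _ _), y * ∏ z ∈ s, a z,
    mul_ne_zero hy0 (Finset.prod_ne_zero_iff.2 fun z _ => ha0 z), fun z hz => ?_,
    fun z hz => ⟨n z, ?_⟩⟩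
  · rw [Algebra.smul_def, IsScalarTower.algebraMap_apply A K L]
    exact mul_ne_zero (by simpa using hy0) hα0
  · rw [mul_comm, mul_smul]
    exact (hy z (Finset.mem_insert_of_mem hz)).smul _
  · rw [← Finset.prod_erase_mul _ _ hz, ← mul_assoc, mul_smul]
    exact Subalgebra.smul_mem _ (ha z) _

/-- Quasi-lifting for finite extensions of the fraction field, through valuation rings. -/
theorem HasSparsePrimes.exists_valuationSubring {A : Type*} (K : Type*) {L : Type*} [CommRing A]
    [IsDomain A] [IsIntegrallyClosed A]
    [Field K] [Algebra A K] [IsFractionRing A K] [Field L] [Algebra K L] [Algebra A L]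
    [IsScalarTower A K L] [FiniteDimensional K L] (hA : HasSparsePrimes A) (s : Finset L) :
    ∃ O : ValuationSubring L, ∃ hO : ∀ a : A, algebraMap A L a ∈ O,
      ∀ z ∈ s, ∃ hz : z ∈ O, IsLocalRing.residue O ⟨z, hz⟩ ∈ perfectClosure
        (Subfield.closure (Set.range fun a => IsLocalRing.residue O ⟨_, hO a⟩))
          (IsLocalRing.ResidueField O) := by
  obtain ⟨α, hα0, hα, g, hg0, hint, hpow⟩ := exists_integral_and_pow_mem_adjoin A K s
  have hinj : Function.Injective (algebraMap A L) := by
    rw [IsScalarTower.algebraMap_eq A K L]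
    exact (algebraMap K L).injective.comp (IsFractionRing.injective A K)
  have : FaithfulSMul A L := (faithfulSMul_iff_algebraMap_injective A L).2 hinj
  have hcoeff : (minpoly A α).coeff 0 ≠ 0 := by
    intro h
    have hαK : IsIntegral K α := hα.tower_top
    apply minpoly.coeff_zero_ne_zero hαK hα0
    rw [minpoly.isIntegrallyClosed_eq_field_fractions' K hα, Polynomial.coeff_map, h, map_zero]
  obtain ⟨P, hprime, hcover, hfin, m, hm0, hm1, hm⟩ := hA
  obtain ⟨p, hp, x, c, hxp, hgp, hroot⟩ := (minpoly.monic hα).exists_mem_prime_eval_scaleRoots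
    hprime hcover hfin hm0 hm1 hm (minpoly.natDegree_pos hα).ne'
    hcoeff hg0
  have := hprime p hp
  obtain ⟨θ, hθ⟩ := exists_adjoin_algHom_residueField hα hxp hroot
  obtain ⟨O, hmem, hO⟩ := exists_valuationSubring_of_ringHom
    (i := (Algebra.adjoin A {α}).val.toRingHom) Subtype.val_injective θ.toRingHom
  have hAO : ∀ a : A, algebraMap A L a ∈ O := fun a => hmem (algebraMap A _ a)
  set F := Subfield.closure (Set.range fun a => IsLocalRing.residue O ⟨_, hAO a⟩) with hF
  have hAF : ∀ a : A, IsLocalRing.residue O ⟨_, hAO a⟩ ∈ F := fun a =>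
    Subfield.subset_closure ⟨a, rfl⟩
  have hne : ∀ a ∉ p, IsLocalRing.residue O ⟨_, hAO a⟩ ≠ 0 := by
    intro a ha h
    have := (hO (algebraMap A _ a)).1 h
    rw [AlgHom.toRingHom_eq_coe, RingHom.coe_coe, AlgHom.commutes,
      Ideal.algebraMap_residueField_eq_zero] at this
    exact ha this
  have hadj : ∀ z ∈ Algebra.adjoin A {α}, ∃ hz : z ∈ O, IsLocalRing.residue O ⟨z, hz⟩ ∈ F := by
    intro z hz
    induction hz using Algebra.adjoin_induction with
    | mem z hz =>
      rw [Set.mem_singleton_iff] at hz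
      subst hz
      have hz : z ∈ O := hmem ⟨z, Algebra.self_mem_adjoin_singleton A z⟩
      have h := (hO _).2 hθ
      have h2 : IsLocalRing.residue O ⟨_, hAO x⟩ * IsLocalRing.residue O ⟨z, hz⟩ =
          IsLocalRing.residue O ⟨_, hAO c⟩ := by
        rw [← sub_eq_zero, ← map_mul, ← map_sub]
        exact h
      refine ⟨hz, ?_⟩
      rw [eq_div_of_mul_eq (hne x hxp) ((mul_comm _ _).trans h2)]
      exact div_mem (hAF c) (hAF x)
    | algebraMap r => exact ⟨hAO r, hAF r⟩
    | add u v _ _ hu hv =>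
      obtain ⟨hu, hu'⟩ := hu
      obtain ⟨hv, hv'⟩ := hv
      exact ⟨add_mem hu hv, add_mem hu' hv'⟩
    | mul u v _ _ hu hv =>
      obtain ⟨hu, hu'⟩ := hu
      obtain ⟨hv, hv'⟩ := hv
      exact ⟨mul_mem hu hv, mul_mem hu' hv'⟩
  refine ⟨O, hAO, fun z hz => ?_⟩
  -- As g is outside p it is a unit of O, so integrality of g • z puts z in O.
  have hgu : IsUnit (⟨_, hAO g⟩ : O) := by
    by_contra h
    exact hne g hgp ((IsLocalRing.residue_eq_zero_iff _).2 h)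
  have hzO : z ∈ O := by
    have h1 : g • z ∈ O := by
      have hint' : IsIntegral O (g • z) :=
        (hint z hz).map_of_comp_eq ((algebraMap A L).codRestrict O hAO) (RingHom.id L) rfl
      obtain ⟨w, hw⟩ := (isIntegrallyClosed_iff L).1 inferInstance hint'
      exact hw ▸ w.2
    obtain ⟨u, hu⟩ := hgu
    have h2 : ((u⁻¹ : Oˣ) : O) * (⟨g • z, h1⟩ : O) ∈ (⊤ : Set O) := trivial
    have h3 : z = (((u⁻¹ : Oˣ) : O) * (⟨g • z, h1⟩ : O) : O) := by
      have h4 : ((u : O) : L) = algebraMap A L g := congr_arg Subtype.val hu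
      have h5 : ((((u⁻¹ : Oˣ) : O) * (u : O) : O) : L) = 1 := by simp
      push_cast at h5 ⊢
      rw [Algebra.smul_def, ← h4, ← mul_assoc, h5, one_mul]
    rw [h3]
    exact Subtype.property _
  refine ⟨hzO, ?_⟩
  obtain ⟨n, hn⟩ := hpow z hz
  refine mem_perfectClosure_of_pow_mem (K := K) (q := ringExpChar K) ((IsLocalRing.residue O).comp
    ((algebraMap A L).codRestrict O hAO)) F (n := n) ?_
  obtain ⟨h1, h2⟩ := hadj _ hn
  have h3 : IsLocalRing.residue O ⟨_, hAO g⟩ * IsLocalRing.residue O ⟨z, hzO⟩ ^ ringExpChar K ^ n =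
      IsLocalRing.residue O ⟨_, h1⟩ := by
    rw [← map_pow, ← map_mul]
    congr 1
    ext
    simp [Algebra.smul_def]
  rw [eq_div_of_mul_eq (hne g hgp) ((mul_comm _ _).trans h3)]
  exact div_mem h2 (hAF g)

/-! ### Algebras of finite type -/

open TensorProduct in
theorem HasSparsePrimes.exists_ringHom_mem_perfectClosure {A B : Type u} [CommRing A]
    [IsDomain A] [IsIntegrallyClosed A] (hA : HasSparsePrimes A) [CommRing B] [Algebra A B]
    [Algebra.FiniteType A B] (hinj : Function.Injective (algebraMap A B)) :
    ∃ (Ω : Type u) (_ : Field Ω) (ψ : B →+* Ω), ∀ b, ψ b ∈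
      perfectClosure (Subfield.closure (Set.range fun a => ψ (algebraMap A B a))) Ω := by
  classical
  let K := FractionRing A
  let T := K ⊗[A] B
  have : Nontrivial T :=
    Algebra.TensorProduct.nontrivial_of_algebraMap_injective_of_flat_left A K B hinj
  obtain ⟨M, hM⟩ := Ideal.exists_maximal T
  let : Field (T ⧸ M) := Ideal.Quotient.field M
  -- Nullstellensatz: a closed point of the generic fibre has residue field finite over K.
  have : Module.Finite K (T ⧸ M) := finite_of_finite_type_of_isJacobsonRing K (T ⧸ M)
  let i : B →ₐ[A] T ⧸ M := (Ideal.Quotient.mkₐ A M).comp Algebra.TensorProduct.includeRight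
  obtain ⟨s, hs⟩ := ‹Algebra.FiniteType A B›.out
  obtain ⟨O, hO, hsO⟩ := hA.exists_valuationSubring K (s.image i)
  have hB : ∀ b : B, ∃ hb : i b ∈ O, IsLocalRing.residue O ⟨i b, hb⟩ ∈ perfectClosure
      (Subfield.closure (Set.range fun a => IsLocalRing.residue O ⟨_, hO a⟩))
        (IsLocalRing.ResidueField O) := by
    intro b
    set F := Subfield.closure (Set.range fun a => IsLocalRing.residue O ⟨_, hO a⟩)
    have hb : b ∈ Algebra.adjoin A (s : Set B) := hs ▸ Algebra.mem_top
    induction hb using Algebra.adjoin_induction with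
    | mem b hb => exact hsO _ (Finset.mem_image_of_mem i hb)
    | algebraMap r =>
      refine ⟨i.commutes r ▸ hO r, ?_⟩
      have : IsLocalRing.residue O ⟨i (algebraMap A B r), i.commutes r ▸ hO r⟩ =
          IsLocalRing.residue O ⟨_, hO r⟩ := by
        congr 2
        exact i.commutes r
      rw [this]
      exact (perfectClosure F _).algebraMap_mem (⟨_, Subfield.subset_closure ⟨r, rfl⟩⟩ : F)
    | add u v _ _ hu hv =>
      obtain ⟨hu, hu'⟩ := hu
      obtain ⟨hv, hv'⟩ := hv
      have := add_mem hu' hv'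
      simp only [← map_add] at this
      exact ⟨map_add i u v ▸ add_mem hu hv, by convert this using 3; exact map_add i u v⟩
    | mul u v _ _ hu hv =>
      obtain ⟨hu, hu'⟩ := hu
      obtain ⟨hv, hv'⟩ := hv
      have := mul_mem hu' hv'
      simp only [← map_mul] at this
      exact ⟨map_mul i u v ▸ mul_mem hu hv, by convert this using 3; exact map_mul i u v⟩
  refine ⟨IsLocalRing.ResidueField O, inferInstance, (IsLocalRing.residue O).comp
    (i.toRingHom.codRestrict O fun b => (hB b).1), fun b => ?_⟩
  have heq : (fun a => ((IsLocalRing.residue O).comp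
      (i.toRingHom.codRestrict O fun b => (hB b).1)) (algebraMap A B a)) =
      fun a => IsLocalRing.residue O ⟨_, hO a⟩ := by
    funext a
    change IsLocalRing.residue O ⟨i (algebraMap A B a), _⟩ = _
    congr 2
    exact i.commutes a
  rw [heq]
  exact (hB b).2

/-! ### Residue fields and passage to schemes -/

open CategoryTheory

theorem IsPurelyInseparableAt.of_comp {X Y Z : Scheme.{u}} {f : X ⟶ Y} {g : Y ⟶ Z} {x : X}
    (h : IsPurelyInseparableAt (f ≫ g) x) :
    IsPurelyInseparableAt f x ∧ IsPurelyInseparableAt g (f x) := by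
  let i₁ : Algebra (Z.residueField (g (f x))) (Y.residueField (f x)) :=
    (g.residueFieldMap (f x)).hom.toAlgebra
  let i₂ : Algebra (Y.residueField (f x)) (X.residueField x) :=
    (f.residueFieldMap x).hom.toAlgebra
  let i₃ : Algebra (Z.residueField (g (f x))) (X.residueField x) :=
    ((f ≫ g).residueFieldMap x).hom.toAlgebra
  have : IsScalarTower (Z.residueField (g (f x))) (Y.residueField (f x)) (X.residueField x) := by
    refine .of_algebraMap_eq fun r => ?_
    change ((f ≫ g).residueFieldMap x).hom r = _
    rw [Scheme.residueFieldMap_comp]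
    rfl
  have : IsPurelyInseparable (Z.residueField (g (f x))) (X.residueField x) := h
  exact ⟨IsPurelyInseparable.tower_top (Z.residueField (g (f x))) (Y.residueField (f x))
    (X.residueField x), IsPurelyInseparable.tower_bot (Z.residueField (g (f x)))
    (Y.residueField (f x)) (X.residueField x)⟩

instance Spec.isPrime_asIdeal {R : CommRingCat.{u}} (P : Spec R) : P.asIdeal.IsPrime :=
  PrimeSpectrum.isPrime P

theorem Spec.algebraMap_residueFieldIso_inv_naturality {A B : CommRingCat.{u}} (φ : A ⟶ B)
    (P : Spec B) :
    CommRingCat.ofHom (algebraMap A (Spec.map φ P).asIdeal.ResidueField) ≫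
      (Scheme.Spec.residueFieldIso A (Spec.map φ P)).inv ≫ (Spec.map φ).residueFieldMap P =
    φ ≫ CommRingCat.ofHom (algebraMap B P.asIdeal.ResidueField) ≫
      (Scheme.Spec.residueFieldIso B P).inv := by
  rw [Scheme.Spec.algebraMap_residueFieldIso_inv_assoc, Scheme.Spec.algebraMap_residueFieldIso_inv]
  have := Scheme.Γevaluation_naturality (Spec.map φ) P
  have h2 := Scheme.ΓSpecIso_inv_naturality φ
  rw [reassoc_of% h2]
  exact congr((Scheme.ΓSpecIso A).inv ≫ $this)

/-- At P = ker ψ, κ(P) embeds in Ω, and the subfield generated by A lies in the image of the residue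
field below. -/
theorem isPurelyInseparableAt_specMap {A B : CommRingCat.{u}} (φ : A ⟶ B) {Ω : Type u} [Field Ω]
    (ψ : B →+* Ω) (h : ∀ b, ψ b ∈
      perfectClosure (Subfield.closure (Set.range fun a => ψ (φ.hom a))) Ω) :
    ∃ P : Spec B, IsPurelyInseparableAt (Spec.map φ) P := by
  obtain ⟨P, hP⟩ : ∃ P : Spec B, P.asIdeal = RingHom.ker ψ :=
    ⟨⟨RingHom.ker ψ, RingHom.ker_isPrime ψ⟩, rfl⟩
  refine ⟨P, ?_⟩
  set F := Subfield.closure (Set.range fun a => ψ (φ.hom a)) with hF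
  let lift : P.asIdeal.ResidueField →+* Ω := Ideal.ResidueField.lift P.asIdeal ψ hP.le (by
    intro b hb
    rw [Submonoid.mem_comap, IsUnit.mem_submonoid_iff, isUnit_iff_ne_zero]
    exact fun h => hb (hP ▸ h))
  have hlift : ∀ b : B, lift (algebraMap B _ b) = ψ b := fun b =>
    Ideal.ResidueField.lift_algebraMap ..
  let ε : (Spec B).residueField P →+* Ω :=
    lift.comp (Scheme.Spec.residueFieldIso B P).hom.hom
  let : Algebra ((Spec A).residueField (Spec.map φ P)) ((Spec B).residueField P) :=
    ((Spec.map φ).residueFieldMap P).hom.toAlgebra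
  let q := ringExpChar Ω
  have hq : ExpChar ((Spec A).residueField (Spec.map φ P)) q :=
    (RingHom.expChar_iff _
      (ε.comp (algebraMap ((Spec A).residueField (Spec.map φ P)) _)).injective q).2 inferInstance
  have hqF : ExpChar F q := (RingHom.expChar_iff _ F.subtype.injective q).2 inferInstance
  have hmem : ∀ z, ε z ∈ perfectClosure F Ω := by
    intro z
    change lift _ ∈ _
    generalize (Scheme.Spec.residueFieldIso B P).hom.hom z = w
    obtain ⟨a, b, hb, rfl⟩ := IsFractionRing.div_surjective (A := B ⧸ P.asIdeal) w
    obtain ⟨a, rfl⟩ := Ideal.Quotient.mk_surjective a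
    obtain ⟨b, rfl⟩ := Ideal.Quotient.mk_surjective b
    rw [Ideal.algebraMap_quotient_residueField_mk, Ideal.algebraMap_quotient_residueField_mk,
      map_div₀, hlift, hlift]
    exact div_mem (h a) (h b)
  have hle : F ≤ (ε.comp (algebraMap ((Spec A).residueField (Spec.map φ P)) _)).fieldRange := by
    rw [hF, Subfield.closure_le]
    rintro _ ⟨a, rfl⟩
    refine ⟨(Scheme.Spec.residueFieldIso A (Spec.map φ P)).inv.hom (algebraMap A _ a), ?_⟩
    have h1 := congr(($(Spec.algebraMap_residueFieldIso_inv_naturality φ P)).hom a)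
    change lift ((Scheme.Spec.residueFieldIso B P).hom.hom (((Spec.map φ).residueFieldMap P).hom
      ((Scheme.Spec.residueFieldIso A (Spec.map φ P)).inv.hom (algebraMap A _ a)))) = _
    have h2 : ((Spec.map φ).residueFieldMap P).hom
      ((Scheme.Spec.residueFieldIso A (Spec.map φ P)).inv.hom (algebraMap A _ a)) =
      (Scheme.Spec.residueFieldIso B P).inv.hom (algebraMap B _ (φ.hom a)) := h1
    rw [h2]
    have h3 := congr(($((Scheme.Spec.residueFieldIso B P).inv_hom_id)).hom
      (algebraMap B _ (φ.hom a)))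
    have h4 : (Scheme.Spec.residueFieldIso B P).hom.hom
      ((Scheme.Spec.residueFieldIso B P).inv.hom (algebraMap B _ (φ.hom a))) =
        algebraMap B _ (φ.hom a) := h3
    rw [h4, hlift]
  change IsPurelyInseparable ((Spec A).residueField (Spec.map φ P)) ((Spec B).residueField P)
  rw [isPurelyInseparable_iff_pow_mem _ q]
  intro z
  obtain ⟨n, y, hy⟩ := (mem_perfectClosure_iff_pow_mem q).1 (hmem z)
  obtain ⟨t, ht⟩ := hle y.2
  refine ⟨n, t, ε.injective ?_⟩
  rw [map_pow, ← hy]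
  exact ht

theorem exists_isAffineOpen_injective_of_isDominant {A : Type u} [CommRing A] [IsDomain A]
    {U : (Spec (.of A)).Opens} (hU : (U : Set (Spec (.of A))).Nonempty) {X : Scheme.{u}}
    (f : X ⟶ U.toScheme) [QuasiCompact f] [IsDominant f] :
    ∃ (W : X.Opens) (hW : IsAffineOpen W),
      Function.Injective (Spec.preimage (hW.fromSpec ≫ f ≫ U.ι)).hom := by
  classical
  by_contra! hcon
  have hex : ∀ (W : X.Opens) (hW : IsAffineOpen W), ∃ a : A, a ≠ 0 ∧
      ∀ x ∈ W, a ∈ ((f ≫ U.ι) x).asIdeal := by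
    intro W hW
    have := hcon W hW
    rw [injective_iff_map_eq_zero] at this
    push Not at this
    obtain ⟨a, ha, ha0⟩ := this
    refine ⟨a, ha0, fun x hx => ?_⟩
    obtain ⟨w, rfl⟩ : x ∈ Set.range hW.fromSpec := by rwa [hW.range_fromSpec]
    have h1 : (f ≫ U.ι) (hW.fromSpec w) =
        Spec.map (Spec.preimage (hW.fromSpec ≫ f ≫ U.ι)) w := by
      rw [Spec.map_preimage]
      rfl
    rw [h1]
    change (Spec.preimage (hW.fromSpec ≫ f ≫ U.ι)).hom a ∈ w.asIdeal
    rw [ha]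
    exact w.asIdeal.zero_mem
  choose a ha0 ha using hex
  obtain ⟨p, hp⟩ := hU
  obtain ⟨_, ⟨g, rfl⟩, hpg, hgU⟩ :=
    PrimeSpectrum.isTopologicalBasis_basic_opens.exists_subset_of_mem_open hp U.isOpen
  have hg0 : g ≠ 0 := by
    rintro rfl
    exact hpg (Ideal.zero_mem _)
  have hVc : IsCompact (U.ι ⁻¹' (PrimeSpectrum.basicOpen g : Set (PrimeSpectrum A))) := by
    refine (U.ι.isOpenEmbedding.isInducing.isCompact_preimage_iff ?_).2
      (PrimeSpectrum.isCompact_basicOpen g)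
    rw [Scheme.Opens.range_ι]
    exact hgU
  have hC : IsCompact (f ⁻¹' (U.ι ⁻¹' (PrimeSpectrum.basicOpen g : Set (PrimeSpectrum A)))) :=
    QuasiCompact.isCompact_preimage _
      ((PrimeSpectrum.basicOpen g).isOpen.preimage U.ι.continuous) hVc
  choose W hW hxW _ using fun x : X =>
    exists_isAffineOpen_mem_and_subset (X := X) (U := ⊤) (x := x) trivial
  obtain ⟨t, -, ht⟩ := hC.elim_nhds_subcover (fun x => (W x : Set X))
    fun x _ => (W x).isOpen.mem_nhds (hxW x)
  -- Each affine open in the finite cover of the preimage of D(g) is killed by one factor, so the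
  -- nonempty open D(b) misses the image of f.
  set b := g * ∏ x ∈ t, a (W x) (hW x) with hb
  have hb0 : b ≠ 0 := mul_ne_zero hg0 (Finset.prod_ne_zero_iff.2 fun x _ => ha0 _ _)
  obtain ⟨y, hy⟩ : (U.ι ⁻¹' (PrimeSpectrum.basicOpen b : Set (PrimeSpectrum A))).Nonempty := by
    have hmem : (⟨⊥, Ideal.isPrime_bot⟩ : PrimeSpectrum A) ∈ PrimeSpectrum.basicOpen b := hb0
    have hle : (PrimeSpectrum.basicOpen b : Set (PrimeSpectrum A)) ⊆ (U : Set (Spec (.of A))) :=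
      (PrimeSpectrum.basicOpen_mul_le_left g _).trans hgU
    exact ⟨⟨_, hle hmem⟩, hmem⟩
  obtain ⟨x, hx⟩ := f.denseRange.exists_mem_open
    ((PrimeSpectrum.basicOpen b).isOpen.preimage U.ι.continuous) ⟨y, hy⟩
  have hxb : b ∉ ((f ≫ U.ι) x).asIdeal := hx
  have hxg : x ∈ f ⁻¹' (U.ι ⁻¹' (PrimeSpectrum.basicOpen g : Set (PrimeSpectrum A))) :=
    PrimeSpectrum.basicOpen_mul_le_left g _ hx
  obtain ⟨x', hx't, hxx'⟩ := Set.mem_iUnion₂.1 (ht hxg)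
  apply hxb
  rw [hb, ← Finset.prod_erase_mul _ _ hx't]
  exact Ideal.mul_mem_left _ _ (Ideal.mul_mem_left _ _ (ha _ _ x hxx'))

theorem HasSparsePrimes.isPoonenRing {A : Type u} [CommRing A] [IsDomain A]
    [IsIntegrallyClosed A] (hA : HasSparsePrimes A) : IsPoonenRing A := by
  intro U hU X f _ _ _ _
  obtain ⟨W, hW, hinj⟩ := exists_isAffineOpen_injective_of_isDominant hU f
  set φ := Spec.preimage (hW.fromSpec ≫ f ≫ U.ι) with hφ
  have hmap : Spec.map φ = hW.fromSpec ≫ f ≫ U.ι := Spec.map_preimage _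
  have hft : φ.hom.FiniteType := by
    rw [← HasRingHomProperty.Spec_iff (P := @LocallyOfFiniteType), hmap]
    infer_instance
  let : Algebra A Γ(X, W) := φ.hom.toAlgebra
  have : Algebra.FiniteType A Γ(X, W) := hft
  obtain ⟨Ω, _, ψ, hψ⟩ := hA.exists_ringHom_mem_perfectClosure hinj
  obtain ⟨P, hP⟩ := isPurelyInseparableAt_specMap φ ψ hψ
  rw [hmap] at hP
  -- In a tower, pure inseparability passes to each step, here to the one induced by f.
  exact ⟨_, _, hP.of_comp.2.of_comp.1, rfl⟩

theorem mainTheorem5 (A : Type u) [CommRing A] [IsDomain A] (hdim : 2 ≤ ringKrullDim A) :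
    (IsKrullRing A → IsPoonenRing A) ∧ (UniqueFactorizationMonoid A → IsPoonenRing A) := by
  refine ⟨fun ⟨V, _, hV, hfin⟩ => ?_, fun _ => ?_⟩
  · have h : IsKrullFamily A V := ⟨hV, hfin⟩
    have := h.isIntegrallyClosed
    exact (h.hasSparsePrimes hdim).isPoonenRing
  · exact (UniqueFactorizationMonoid.hasSparsePrimes hdim).isPoonenRing
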